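/- **Definitions.** A Motzkin tree is a rooted plane unary-binary tree; its size is its total number of nodes. A closed lambda-term (up to renaming of bound variables) is a Motzkin tree together with, for each leaf, a pointer to that leaf from exactly one of the unary nodes that are its ancestors (leaves are variables, unary nodes abstractions, binary nodes applications); its size is the size of the tree, i.e. $|x|=1$, $|\lambda x.T|=1+|T|$, $|(S*T)|=1+|S|+|T|$. Let $\lambda_n$ be the number of closed lambda-terms of size $n$ and $\Lambda(z)=\sum_{n\ge 1}\lambda_n z^n$. Let $M(z,u)$ be the generating function of Motzkin trees, where $z$ marks the size and $u$ marks the number of leaves. All series are formal power series with real coefficients. **Proposition.** Let $C(z)=\bigl(1-\sqrt{1-4z^2}\,\bigr)/2$. This is the generating function, by total number of nodes, of binary trees with an extra unary root node. There is exactly one formal power series $\tilde\Lambda(z)$ satisfying $$\tilde\Lambda(z)=C(z)+z\,\tilde\Lambda(z)^2+z\,\tilde\Lambda\!\left(\frac{z}{1-2C(z)}\right)-z\,\tilde\Lambda(z),$$ and for this series $$\Lambda(z)=\tilde\Lambda\!\left(\frac{z}{1-z}\right).$$ Moreover, $$\Lambda(z)=z\,M(z,1)+z\,\Lambda(z)^2+z\,\Lambda\!\left(\frac{z}{1-2z\,M(z,1)}\right).$$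 -/

import Mathlib

namespace LambdaEnum

/-- Rooted plane unary-binary trees. -/
inductive MotzkinTree : Type
  | leaf : MotzkinTree
  | unary : MotzkinTree → MotzkinTree
  | binary : MotzkinTree → MotzkinTree → MotzkinTree

namespace MotzkinTree

/-- The size of a tree is its total number of nodes. -/
def size : MotzkinTree → ℕ
  | leaf => 1
  | unary t => 1 + size t
  | binary l r => 1 + size l + size r

/-- The number of leaves of a tree. -/
def leaves : MotzkinTree → ℕ
  | leaf => 1
  | unary t => leaves t
  | binary l r => leaves l + leaves r

/-- A binary tree is a tree without unary nodes. -/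
def IsBinary : MotzkinTree → Prop
  | leaf => True
  | unary _ => False
  | binary l r => IsBinary l ∧ IsBinary r

/-- `Pointers t d`: all ways to bind every leaf of `t` by exactly one of the unary nodes above it,
where `t` is regarded as a subtree having `d` unary nodes above its root (these are numbered
by their distance from the leaf). Below a unary node one more unary ancestor is available, and
the leaves of the two branches of a binary node are bound independently. -/
def Pointers : MotzkinTree → ℕ → Type
  | leaf, d => Fin d
  | unary t, d => Pointers t (d + 1)
  | binary l r, d => Pointers l d × Pointers r d

end MotzkinTree

/-- A closed lambda-term up to renaming of bound variables, as an enriched tree: a unary-binary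
tree (leaves are variables, unary nodes are abstractions, binary nodes are applications)
together with, for each leaf, the choice of a unary ancestor binding it. -/
structure ClosedTerm : Type where
  tree : MotzkinTree
  pointers : tree.Pointers 0

/-- `|x| = 1`, `|λx.T| = 1 + |T|`, `|(S * T)| = 1 + |S| + |T|`. -/
def ClosedTerm.size (T : ClosedTerm) : ℕ := T.tree.size

/-! The classes counted below are finite, so that `Nat.card` is the true number of elements. -/

theorem MotzkinTree.size_pos (t : MotzkinTree) : 0 < t.size := by
  cases t <;> simp only [MotzkinTree.size] <;> omega

theorem MotzkinTree.finite_size_le (n : ℕ) : {t : MotzkinTree | t.size ≤ n}.Finite := by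
  induction n with
  | zero =>
    refine Set.Finite.subset Set.finite_empty ?_
    intro t ht
    have h1 := t.size_pos
    have h2 : t.size ≤ 0 := ht
    omega
  | succ n ih =>
    refine Set.Finite.subset (((Set.finite_singleton MotzkinTree.leaf).union
      (ih.image MotzkinTree.unary)).union (Set.Finite.image2 MotzkinTree.binary ih ih)) ?_
    intro t ht
    have h2 : t.size ≤ n + 1 := ht
    cases t with
    | leaf => exact Or.inl (Or.inl rfl)
    | unary t =>
      simp only [MotzkinTree.size] at h2
      exact Or.inl (Or.inr ⟨t, show t.size ≤ n by omega, rfl⟩)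
    | binary l r =>
      simp only [MotzkinTree.size] at h2
      exact Or.inr ⟨l, show l.size ≤ n by omega, r, show r.size ≤ n by omega, rfl⟩

theorem MotzkinTree.finite_pointers (t : MotzkinTree) : ∀ d : ℕ, Finite (t.Pointers d) := by
  induction t with
  | leaf => intro d; exact inferInstanceAs (Finite (Fin d))
  | unary t ih => intro d; exact ih (d + 1)
  | binary l r ihl ihr =>
    intro d
    have h1 := ihl d
    have h2 := ihr d
    exact inferInstanceAs (Finite (l.Pointers d × r.Pointers d))

theorem ClosedTerm.finite_size_eq (n : ℕ) : Finite {T : ClosedTerm // T.size = n} := by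
  have h1 : Finite {t : MotzkinTree // t.size ≤ n} := MotzkinTree.finite_size_le n
  have h2 : ∀ t : {t : MotzkinTree // t.size ≤ n}, Finite (t.1.Pointers 0) :=
    fun t => t.1.finite_pointers 0
  refine Finite.of_injective (β := Σ t : {t : MotzkinTree // t.size ≤ n}, t.1.Pointers 0)
    (fun T => ⟨⟨T.1.tree, T.2.le⟩, T.1.pointers⟩) ?_
  rintro ⟨⟨t, p⟩, h⟩ ⟨⟨t', p'⟩, h'⟩ he
  simp only [Sigma.mk.injEq] at he
  obtain ⟨h1, he⟩ := he
  obtain rfl : t = t' := congrArg Subtype.val h1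
  cases he
  rfl

noncomputable section

/-- The number of closed lambda-terms of size `n`. -/
def numClosed (n : ℕ) : ℕ := Nat.card {T : ClosedTerm // T.size = n}

/-- The generating function of closed lambda-terms. -/
def closedGF : PowerSeries ℝ := PowerSeries.mk fun n => (numClosed n : ℝ)

/-- The number of Motzkin trees of size `n` with `k` leaves. -/
def numMotzkin (n k : ℕ) : ℕ := Nat.card {t : MotzkinTree // t.size = n ∧ t.leaves = k}

/-- The generating function `M(z,u)` of Motzkin trees, as a power series in `z` (marking the size)
whose coefficients are polynomials in `u` (marking the leaves; a tree of size `n` has at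
most `n` leaves). -/
def motzkinGF : PowerSeries (Polynomial ℝ) :=
  PowerSeries.mk fun n =>
    ∑ k ∈ Finset.range (n + 1), Polynomial.monomial k (numMotzkin n k : ℝ)

/-- `M(z,1)`. -/
def motzkinAtOne : PowerSeries ℝ := PowerSeries.map (Polynomial.evalRingHom 1) motzkinGF

/-- The formal square root `√f = ∑ k, (1/2 choose k) (f - 1)^k` of a power series `f` with
constant coefficient `1`. -/
def formalSqrt (f : PowerSeries ℝ) : PowerSeries ℝ :=
  (PowerSeries.binomialSeries ℝ (1 / 2 : ℝ)).subst (f - 1)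

/-- `C(z) = (1 - √(1 - 4z²)) / 2`. -/
def catalanC : PowerSeries ℝ :=
  (1 / 2 : ℝ) • (1 - formalSqrt (1 - 4 * PowerSeries.X ^ 2))

/-- The generating function of binary trees with an extra unary root node, counted by the total
number of nodes. -/
def rootedBinaryGF : PowerSeries ℝ :=
  PowerSeries.mk fun n =>
    (Nat.card {t : MotzkinTree // t.IsBinary ∧ (MotzkinTree.unary t).size = n} : ℝ)

/-- `F(G(z))` for power series in one variable, `G` having constant coefficient `0`. -/
def comp (F G : PowerSeries ℝ) : PowerSeries ℝ := F.subst G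

/-- The functional equation
`L(z) = C(z) + z L(z)² + z L(z / (1 - 2 C(z))) - z L(z)`. -/
def IndirectEquation (L : PowerSeries ℝ) : Prop :=
  L = catalanC + PowerSeries.X * L ^ 2
    + PowerSeries.X * comp L (PowerSeries.X * (1 - 2 * catalanC)⁻¹) - PowerSeries.X * L

end

end LambdaEnum

/-! Let O_d count terms with at most d free variables, so O_0 = Λ. Splitting at the root gives O_d =
z(d + O_{d+1} + O_d²), a system that never closes by itself. The key is `openGF_succ`: O_{d+1} = M +
O_d(z/(1 - 2zM)). Both sides, as families in d, solve the shifted system, and such a system has one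
solution because every use of an equation gains a factor z. At d = 0 this is the functional equation
for Λ.

Substituting z/(1+z) turns M = z(1 + M + M²) into the binary-tree equation, so zM becomes C, and the
functional equation of Λ becomes the indirect one. Its solution is unique, again by the factor z,
and z/(1-z) inverts z/(1+z). -/

namespace LambdaEnum

open PowerSeries

noncomputable section

/-! ### Counting generating functions -/

/-- The generating function of a class `α` with size function `s`. -/
def countGF {α : Type} (s : α → ℕ) : PowerSeries ℝ :=
  PowerSeries.mk fun n => (Nat.card {a // s a = n} : ℝ)

/-- There are finitely many objects of every size. -/
def FiniteFibers {α : Type} (s : α → ℕ) : Prop := ∀ n, Finite {a // s a = n}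

theorem countGF_congr {α β : Type} {s : α → ℕ} {t : β → ℕ} (e : α ≃ β)
    (h : ∀ a, s a = t (e a)) : countGF s = countGF t := by
  ext n
  simp only [countGF, coeff_mk]
  exact congrArg _ (Nat.card_congr (e.subtypeEquiv fun a => by rw [h a]))

/-- Finiteness is essential: `Nat.card` is 0 on infinite types, which would break additivity. -/
theorem countGF_sum {α β : Type} {s : α → ℕ} {t : β → ℕ} (hs : FiniteFibers s)
    (ht : FiniteFibers t) : countGF (Sum.elim s t) = countGF s + countGF t := by
  ext n
  have := hs n
  have := ht n
  have h : Nat.card {x // Sum.elim s t x = n}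
      = Nat.card {a // s a = n} + Nat.card {b // t b = n} := by
    rw [← Nat.card_sum]
    exact Nat.card_congr Equiv.subtypeSum
  simp only [countGF, coeff_mk, map_add, h, Nat.cast_add]

/-- Pairs of total size `n`, sorted by the sizes of the components. -/
def pairFiberEquiv {α β : Type} (s : α → ℕ) (t : β → ℕ) (n : ℕ) :
    {p : α × β // s p.1 + t p.2 = n} ≃
      Σ ij : Finset.HasAntidiagonal.antidiagonal n, {a // s a = ij.1.1} × {b // t b = ij.1.2} where
  toFun p := ⟨⟨(s p.1.1, t p.1.2), Finset.HasAntidiagonal.mem_antidiagonal.2 p.2⟩, ⟨p.1.1, rfl⟩, ⟨p.1.2, rfl⟩⟩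
  invFun q := ⟨(q.2.1.1, q.2.2.1), by
    rw [q.2.1.2, q.2.2.2]; exact Finset.HasAntidiagonal.mem_antidiagonal.1 q.1.2⟩
  left_inv _ := rfl
  right_inv := by
    rintro ⟨⟨⟨i, j⟩, _⟩, ⟨a, ha⟩, ⟨b, hb⟩⟩
    change s a = i at ha
    change t b = j at hb
    subst ha hb
    rfl

theorem FiniteFibers.prod {α β : Type} {s : α → ℕ} {t : β → ℕ} (hs : FiniteFibers s)
    (ht : FiniteFibers t) : FiniteFibers fun p : α × β => s p.1 + t p.2 := by
  intro n
  have := fun i => hs i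
  have := fun i => ht i
  exact Finite.of_equiv _ (pairFiberEquiv s t n).symm

theorem FiniteFibers.sum {α β : Type} {s : α → ℕ} {t : β → ℕ} (hs : FiniteFibers s)
    (ht : FiniteFibers t) : FiniteFibers (Sum.elim s t) := by
  intro n
  have := hs n
  have := ht n
  exact Finite.of_equiv ({a // s a = n} ⊕ {b // t b = n})
    (Equiv.subtypeSum (p := fun x => Sum.elim s t x = n)).symm

theorem countGF_prod {α β : Type} {s : α → ℕ} {t : β → ℕ} (hs : FiniteFibers s)
    (ht : FiniteFibers t) :
    countGF (fun p : α × β => s p.1 + t p.2) = countGF s * countGF t := by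
  ext n
  have := fun i => hs i
  have := fun i => ht i
  have h : Nat.card {p : α × β // s p.1 + t p.2 = n}
      = ∑ ij ∈ Finset.HasAntidiagonal.antidiagonal n, Nat.card {a // s a = ij.1} * Nat.card {b // t b = ij.2} := by
    rw [Nat.card_congr (pairFiberEquiv s t n), Nat.card_sigma,
      ← Finset.sum_coe_sort (Finset.HasAntidiagonal.antidiagonal n)]
    exact Finset.sum_congr rfl fun ij _ => Nat.card_prod _ _
  rw [coeff_mul]
  simp only [countGF, coeff_mk, h, Nat.cast_sum, Nat.cast_mul]

theorem countGF_succ {α : Type} (s : α → ℕ) : countGF (fun a => s a + 1) = X * countGF s := by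
  ext n
  cases n with
  | zero =>
    have : IsEmpty {a // s a + 1 = 0} := ⟨fun a => absurd a.2 (Nat.succ_ne_zero _)⟩
    simp [countGF]
  | succ n =>
    rw [coeff_succ_X_mul]
    simp [countGF]

theorem countGF_zero (α : Type) : countGF (fun _ : α => 0) = C (Nat.card α : ℝ) := by
  ext n
  rw [coeff_C]
  split_ifs with h
  · subst h
    rw [countGF, coeff_mk]
    exact congrArg _ (Nat.card_congr (Equiv.subtypeUnivEquiv fun _ => rfl))
  · have : IsEmpty {a : α // 0 = n} := ⟨fun a => h a.2.symm⟩
    simp [countGF]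

theorem finiteFibers_of_finite {α : Type} [Finite α] (s : α → ℕ) : FiniteFibers s :=
  fun _ => inferInstance

/-! ### Functional equations for trees and terms -/

namespace MotzkinTree

theorem finiteFibers_size : FiniteFibers size := fun n =>
  ((finite_size_le n).subset fun t (h : t.size = n) => h.le : {t | size t = n}.Finite)

theorem leaves_le_size (t : MotzkinTree) : t.leaves ≤ t.size := by
  induction t <;> simp only [leaves, size] <;> omega

/-- A tree is a leaf, or has a unary root, or has a binary root. -/
def decompose : MotzkinTree ≃ Unit ⊕ (MotzkinTree ⊕ (MotzkinTree × MotzkinTree)) where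
  toFun
    | leaf => .inl ()
    | unary t => .inr (.inl t)
    | binary l r => .inr (.inr (l, r))
  invFun
    | .inl _ => leaf
    | .inr (.inl t) => unary t
    | .inr (.inr (l, r)) => binary l r
  left_inv t := by cases t <;> rfl
  right_inv x := by rcases x with _ | _ | _ <;> rfl

theorem countGF_size :
    countGF size = X * (1 + (countGF size + countGF size ^ 2)) := by
  have h := finiteFibers_size
  have e := countGF_congr (s := size) (t := fun x => Sum.elim (fun _ => 0)
    (Sum.elim size (fun p : MotzkinTree × MotzkinTree => size p.1 + size p.2)) x + 1) decompose
    (by rintro (_ | _ | _) <;> simp only [decompose, Equiv.coe_fn_mk, Sum.elim_inl,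
          Sum.elim_inr, size] <;> omega)
  rw [countGF_succ, countGF_sum (finiteFibers_of_finite _) (h.sum (h.prod h)),
    countGF_sum h (h.prod h), countGF_prod h h, countGF_zero] at e
  simpa [sq] using e

/-- A binary tree is a leaf or has a binary root. -/
def binaryDecompose : {t : MotzkinTree // t.IsBinary} ≃
    Unit ⊕ ({t : MotzkinTree // t.IsBinary} × {t : MotzkinTree // t.IsBinary}) where
  toFun
    | ⟨leaf, _⟩ => .inl ()
    | ⟨unary _, h⟩ => h.elim
    | ⟨binary l r, h⟩ => .inr (⟨l, h.1⟩, ⟨r, h.2⟩)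
  invFun
    | .inl _ => ⟨leaf, trivial⟩
    | .inr (l, r) => ⟨binary l.1 r.1, l.2, r.2⟩
  left_inv := by
    rintro ⟨_ | _ | _, h⟩
    · rfl
    · exact h.elim
    · rfl
  right_inv x := by rcases x with _ | _ <;> rfl

theorem countGF_binary :
    countGF (fun t : {t : MotzkinTree // t.IsBinary} => t.1.size)
      = X * (1 + countGF (fun t : {t : MotzkinTree // t.IsBinary} => t.1.size) ^ 2) := by
  have h : FiniteFibers (fun t : {t : MotzkinTree // t.IsBinary} => t.1.size) := fun n => by
    have := finiteFibers_size n
    exact Finite.of_injective (β := {t : MotzkinTree // t.size = n})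
      (fun t => ⟨t.1.1, t.2⟩) fun a b hab =>
        Subtype.ext (Subtype.ext (congrArg (fun x => x.1) hab))
  have e := countGF_congr (s := fun t : {t : MotzkinTree // t.IsBinary} => t.1.size)
    (t := fun x => Sum.elim (fun _ => 0) (fun p : {t : MotzkinTree // t.IsBinary} ×
      {t : MotzkinTree // t.IsBinary} => p.1.1.size + p.2.1.size) x + 1) binaryDecompose
    (by
      rintro ⟨_ | _ | _, hb⟩
      · rfl
      · exact hb.elim
      · simp only [binaryDecompose, Equiv.coe_fn_mk, Sum.elim_inr, size]; omega)
  rw [countGF_succ, countGF_sum (finiteFibers_of_finite _) (h.prod h), countGF_prod h h,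
    countGF_zero] at e
  simpa [sq] using e

end MotzkinTree

/-- Setting u = 1 forgets the number of leaves; truncating at k ≤ n loses no tree, since leaves
never outnumber nodes. -/
theorem motzkinAtOne_eq : motzkinAtOne = countGF MotzkinTree.size := by
  ext n
  have hn := MotzkinTree.finiteFibers_size n
  have h : Nat.card {t : MotzkinTree // t.size = n}
      = ∑ k ∈ Finset.range (n + 1), numMotzkin n k := by
    have hk : ∀ k, Finite {t : MotzkinTree // t.size = n ∧ t.leaves = k} := fun k =>
      Finite.of_injective (β := {t : MotzkinTree // t.size = n}) (fun t => ⟨t.1, t.2.1⟩)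
        fun a b hab => Subtype.ext (congrArg (fun x => x.1) hab)
    let e : {t : MotzkinTree // t.size = n} ≃
        Σ k : Finset.range (n + 1), {t : MotzkinTree // t.size = n ∧ t.leaves = k.1} :=
      { toFun := fun t => ⟨⟨t.1.leaves, Finset.mem_range.2
          (Nat.lt_succ_of_le (t.1.leaves_le_size.trans t.2.le))⟩, t.1, t.2, rfl⟩
        invFun := fun q => ⟨q.2.1, q.2.2.1⟩
        left_inv := fun _ => rfl
        right_inv := by
          rintro ⟨⟨k, _⟩, t, ht, h⟩
          change t.leaves = k at h
          subst h
          rfl }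
    rw [Nat.card_congr e, Nat.card_sigma, ← Finset.sum_coe_sort (Finset.range (n + 1))]
    rfl
  simp [motzkinAtOne, motzkinGF, countGF, h, map_sum]

theorem rootedBinaryGF_eq : rootedBinaryGF
    = X * countGF (fun t : {t : MotzkinTree // t.IsBinary} => t.1.size) := by
  rw [← countGF_succ]
  ext n
  simp only [rootedBinaryGF, countGF, coeff_mk]
  refine congrArg _ (Nat.card_congr ((Equiv.subtypeSubtypeEquivSubtypeInter _ _).symm.trans
    (Equiv.subtypeEquivRight fun t => ?_)))
  simp only [MotzkinTree.size]
  omega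

/-- Lambda-terms with at most `d` free variables, as enriched trees. -/
abbrev OpenTerm (d : ℕ) : Type := Σ t : MotzkinTree, t.Pointers d

/-- The size of an open term. -/
def OpenTerm.size {d : ℕ} (T : OpenTerm d) : ℕ := T.1.size

theorem OpenTerm.finiteFibers_size (d : ℕ) : FiniteFibers (OpenTerm.size (d := d)) := by
  intro n
  have h1 := MotzkinTree.finiteFibers_size n
  have h2 : ∀ t : {t : MotzkinTree // t.size = n}, Finite (t.1.Pointers d) :=
    fun t => t.1.finite_pointers d
  refine Finite.of_injective (β := Σ t : {t : MotzkinTree // t.size = n}, t.1.Pointers d)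
    (fun T => ⟨⟨T.1.1, T.2⟩, T.1.2⟩) ?_
  rintro ⟨⟨t, p⟩, h⟩ ⟨⟨t', p'⟩, h'⟩ he
  simp only [Sigma.mk.injEq] at he
  obtain ⟨h1, he⟩ := he
  obtain rfl : t = t' := congrArg Subtype.val h1
  cases he
  rfl

/-- An open term is a variable, an abstraction or an application. -/
def OpenTerm.decompose (d : ℕ) :
    OpenTerm d ≃ Fin d ⊕ (OpenTerm (d + 1) ⊕ (OpenTerm d × OpenTerm d)) where
  toFun
    | ⟨.leaf, i⟩ => .inl i
    | ⟨.unary t, p⟩ => .inr (.inl ⟨t, p⟩)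
    | ⟨.binary l r, p⟩ => .inr (.inr (⟨l, p.1⟩, ⟨r, p.2⟩))
  invFun
    | .inl i => ⟨.leaf, i⟩
    | .inr (.inl T) => ⟨.unary T.1, T.2⟩
    | .inr (.inr (S, T)) => ⟨.binary S.1 T.1, (S.2, T.2)⟩
  left_inv := by rintro ⟨_ | _ | _, p⟩ <;> rfl
  right_inv x := by rcases x with _ | _ | _ <;> rfl

/-- The generating function of open terms. -/
def openGF (d : ℕ) : PowerSeries ℝ := countGF (OpenTerm.size (d := d))

/-- The body of an abstraction may use one more variable, hence the index d + 1. -/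
theorem openGF_eq (d : ℕ) : openGF d = X * (C (d : ℝ) + (openGF (d + 1) + openGF d ^ 2)) := by
  have h := OpenTerm.finiteFibers_size d
  have h' := OpenTerm.finiteFibers_size (d + 1)
  have e := countGF_congr (s := OpenTerm.size (d := d)) (t := fun x => Sum.elim (fun _ => 0)
    (Sum.elim OpenTerm.size
      (fun p : OpenTerm d × OpenTerm d => OpenTerm.size p.1 + OpenTerm.size p.2)) x + 1)
    (OpenTerm.decompose d)
    (by
      rintro ⟨_ | t | ⟨l, r⟩, p⟩
      · rfl
      · exact Nat.add_comm 1 t.size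
      · change 1 + l.size + r.size = l.size + r.size + 1
        omega)
  rw [countGF_succ, countGF_sum (finiteFibers_of_finite _) (h'.sum (h.prod h)),
    countGF_sum h' (h.prod h), countGF_prod h h, countGF_zero, Nat.card_fin] at e
  rw [openGF, openGF, sq]
  exact e

theorem closedGF_eq_openGF : closedGF = openGF 0 := by
  exact countGF_congr (s := ClosedTerm.size) (t := OpenTerm.size)
    { toFun := fun T => ⟨T.tree, T.pointers⟩
      invFun := fun T => ⟨T.1, T.2⟩
      left_inv := fun _ => rfl
      right_inv := fun _ => rfl } fun _ => rfl

/-! ### Formal power series -/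

theorem eq_of_forall_X_pow_dvd_sub {F G : PowerSeries ℝ} (h : ∀ n : ℕ, X ^ n ∣ F - G) :
    F = G := by
  rw [← sub_eq_zero]
  ext n
  exact X_pow_dvd_iff.1 (h (n + 1)) n n.lt_succ_self

/-- Composition with a power series without constant term, as a ring homomorphism. -/
theorem exists_ringHom_comp {G : PowerSeries ℝ} (hG : constantCoeff G = 0) :
    ∃ φ : PowerSeries ℝ →+* PowerSeries ℝ, (∀ F, φ F = comp F G) ∧ φ X = G ∧
      ∀ r, φ (C r) = C r := by
  have h : HasSubst G := HasSubst.of_constantCoeff_zero' hG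
  refine ⟨(substAlgHom (R := ℝ) h : PowerSeries ℝ →ₐ[ℝ] PowerSeries ℝ).toRingHom,
    fun F => ?_, substAlgHom_X h, fun r => ?_⟩
  · exact congrFun (coe_substAlgHom h) F
  · exact (substAlgHom (R := ℝ) h : PowerSeries ℝ →ₐ[ℝ] PowerSeries ℝ).commutes r

theorem comp_comp (F : PowerSeries ℝ) {G H : PowerSeries ℝ} (hG : constantCoeff G = 0)
    (hH : constantCoeff H = 0) : comp (comp F G) H = comp F (comp G H) :=
  subst_comp_subst_apply (HasSubst.of_constantCoeff_zero' hG)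
    (HasSubst.of_constantCoeff_zero' hH) F

theorem constantCoeff_X_mul_eq_zero (F : PowerSeries ℝ) : constantCoeff (X * F) = 0 := by
  simp

theorem constantCoeff_comp_eq_zero {F G : PowerSeries ℝ} (hF : constantCoeff F = 0)
    (hG : constantCoeff G = 0) : constantCoeff (comp F G) = 0 :=
  constantCoeff_subst_eq_zero hG F hF

/-- Composition sends z^n to G^n, which z^n divides because G has no constant term. -/
theorem X_pow_dvd_comp_sub {F F' G : PowerSeries ℝ} (hG : constantCoeff G = 0) {n : ℕ}
    (h : X ^ n ∣ F - F') : X ^ n ∣ comp F G - comp F' G := by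
  obtain ⟨φ, h1, h2, -⟩ := exists_ringHom_comp hG
  rw [← h1, ← h1, ← map_sub]
  refine (pow_dvd_pow_of_dvd (X_dvd_iff.2 hG) n).trans ?_
  rw [← h2, ← map_pow]
  exact map_dvd φ h

theorem X_pow_dvd_sq_sub_sq {F G : PowerSeries ℝ} {n : ℕ} (h : X ^ n ∣ F - G) :
    X ^ n ∣ F ^ 2 - G ^ 2 := by
  rw [sq_sub_sq]
  exact h.mul_left _

/-- The system `F d = z (a d + F (d + 1) + F d ^ 2)` has at most one solution. -/
theorem system_unique {a F G : ℕ → PowerSeries ℝ}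
    (hF : ∀ d, F d = X * (a d + (F (d + 1) + F d ^ 2)))
    (hG : ∀ d, G d = X * (a d + (G (d + 1) + G d ^ 2))) : F = G := by
  -- All d are treated at once, since the equation for d calls on d + 1.
  have key : ∀ n : ℕ, ∀ d, X ^ n ∣ F d - G d := by
    intro n
    induction n with
    | zero => simp
    | succ n ih =>
      intro d
      have e : F d - G d = X * ((F (d + 1) - G (d + 1)) + (F d ^ 2 - G d ^ 2)) := by
        conv_lhs => rw [hF d, hG d]
        ring
      rw [e, pow_succ']
      exact mul_dvd_mul_left _ (dvd_add (ih _) (X_pow_dvd_sq_sub_sq (ih d)))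
  exact funext fun d => eq_of_forall_X_pow_dvd_sub fun n => key n d

theorem indirectEquation_unique {F G : PowerSeries ℝ} (hF : IndirectEquation F)
    (hG : IndirectEquation G) : F = G := by
  refine eq_of_forall_X_pow_dvd_sub fun n => ?_
  induction n with
  | zero => simp
  | succ n ih =>
    set V : PowerSeries ℝ := X * (1 - 2 * catalanC)⁻¹ with hV
    have e : F - G = X * ((F ^ 2 - G ^ 2) + (comp F V - comp G V) - (F - G)) := by
      unfold IndirectEquation at hF hG
      rw [← hV] at hF hG
      linear_combination hF - hG
    rw [e, pow_succ']
    exact mul_dvd_mul_left _ (dvd_sub (dvd_add (X_pow_dvd_sq_sub_sq ih)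
      (X_pow_dvd_comp_sub (constantCoeff_X_mul_eq_zero _) ih)) ih)

theorem constantCoeff_formalSqrt {f : PowerSeries ℝ} (hf : constantCoeff f = 1) :
    constantCoeff (formalSqrt f) = 1 := by
  have h0 : constantCoeff (f - 1) = 0 := by simp [hf]
  obtain ⟨φ, h1, -, h3⟩ := exists_ringHom_comp h0
  have h2 : constantCoeff (comp (PowerSeries.binomialSeries ℝ (1 / 2 : ℝ) - 1) (f - 1)) = 0 :=
    constantCoeff_comp_eq_zero (by simp) h0
  rw [← h1, map_sub, map_one, h1, map_sub, map_one, sub_eq_zero] at h2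
  exact h2

/-- Exponents of binomial series add, so the series for 1/2 squares to 1 + z. -/
theorem formalSqrt_sq {f : PowerSeries ℝ} (hf : constantCoeff f = 1) :
    formalSqrt f ^ 2 = f := by
  have h0 : constantCoeff (f - 1) = 0 := by simp [hf]
  obtain ⟨φ, h1, h2, -⟩ := exists_ringHom_comp h0
  have hb : PowerSeries.binomialSeries ℝ (1 / 2 : ℝ) ^ 2 = 1 + X := by
    rw [sq, ← binomialSeries_add, show (1 / 2 + 1 / 2 : ℝ) = ((1 : ℕ) : ℝ) by norm_num,
      binomialSeries_nat, pow_one]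
  change comp _ _ ^ 2 = f
  rw [← h1, ← map_pow, hb, map_add, map_one, h2]
  ring

theorem constantCoeff_catalanC : constantCoeff catalanC = 0 := by
  have h := constantCoeff_formalSqrt (f := 1 - 4 * X ^ 2) (by simp)
  rw [catalanC, ← coeff_zero_eq_constantCoeff_apply, coeff_smul, map_sub,
    coeff_zero_eq_constantCoeff_apply, coeff_zero_eq_constantCoeff_apply, h]
  simp

theorem catalanC_eq : catalanC = X ^ 2 + catalanC ^ 2 := by
  have h := formalSqrt_sq (f := 1 - 4 * X ^ 2) (by simp)
  have h2 : 2 * catalanC = 1 - formalSqrt (1 - 4 * X ^ 2) := by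
    rw [catalanC, two_mul, ← add_smul]
    norm_num
  have h4 : (4 : PowerSeries ℝ) * (X ^ 2 + catalanC ^ 2 - catalanC) = 0 := by
    linear_combination h + (2 * catalanC - 1 - formalSqrt (1 - 4 * X ^ 2)) * h2
  have h5 : (4 : PowerSeries ℝ) ≠ 0 := fun h => by
    have := congrArg (constantCoeff (R := ℝ)) h
    rw [map_ofNat, map_zero] at this
    norm_num at this
  exact (sub_eq_zero.1 ((mul_eq_zero.1 h4).resolve_left h5)).symm

/-- `F = z² + F²` determines a power series without constant term. -/
theorem eq_catalanC {F : PowerSeries ℝ} (h0 : constantCoeff F = 0) (h : F = X ^ 2 + F ^ 2) :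
    F = catalanC := by
  -- The second factor has constant coefficient 1, so the first must vanish.
  have e : (F - catalanC) * (1 - (F + catalanC)) = 0 := by
    linear_combination h - catalanC_eq
  refine sub_eq_zero.1 ((mul_eq_zero.1 e).resolve_right fun h1 => ?_)
  have := congrArg constantCoeff h1
  simp [h0, constantCoeff_catalanC] at this

/-! ### The functional equations -/

theorem motzkinAtOne_functional :
    motzkinAtOne = X * (1 + (motzkinAtOne + motzkinAtOne ^ 2)) := by
  rw [motzkinAtOne_eq]
  exact MotzkinTree.countGF_size

/-- Multiplying B = z(1 + B²) by z shows that zB solves F = z² + F². -/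
theorem catalanC_eq_rootedBinaryGF : catalanC = rootedBinaryGF := by
  rw [rootedBinaryGF_eq]
  refine (eq_catalanC (constantCoeff_X_mul_eq_zero _) ?_).symm
  linear_combination X * MotzkinTree.countGF_binary

/-- Inserting one more free variable: a term either uses only the new variable, or arises from a
term without it by putting sequences of binary nodes with pendant Motzkin trees above
the nodes. -/
theorem openGF_succ (d : ℕ) : openGF (d + 1) = motzkinAtOne
    + comp (openGF d) (X * (1 - 2 * X * motzkinAtOne)⁻¹) := by
  set M := motzkinAtOne
  set P : PowerSeries ℝ := X * (1 - 2 * X * M)⁻¹ with hP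
  have hP0 : constantCoeff P = 0 := constantCoeff_X_mul_eq_zero _
  have hPM : P * (1 - 2 * X * M) = X := by
    rw [hP, mul_assoc, PowerSeries.inv_mul_cancel _ (by simp), mul_one]
  obtain ⟨φ, h1, h2, h3⟩ := exists_ringHom_comp hP0
  have := system_unique (a := fun d => C ((d + 1 : ℕ) : ℝ)) (F := fun d => openGF (d + 1))
    (G := fun d => M + φ (openGF d)) (fun d => openGF_eq (d + 1)) fun d => by
      have hT := congrArg φ (openGF_eq d)
      rw [map_mul, map_add, map_add, map_pow, h2, h3] at hT
      have hM : M = X * (1 + (M + M ^ 2)) := motzkinAtOne_functional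
      have hC : C ((d + 1 : ℕ) : ℝ) = C (d : ℝ) + 1 := by
        rw [Nat.cast_succ, map_add, map_one]
      rw [hC]
      -- Clearing the denominator of P produces the term 2zM·φ(O_d), exactly the cross term of (M +
      -- φ(O_d))².
      linear_combination hM + (1 - 2 * X * M) * hT
        + (C (d : ℝ) + (φ (openGF (d + 1)) + φ (openGF d) ^ 2)) * hPM
  rw [← h1]
  exact congrFun this d

theorem closedGF_functional : closedGF = X * motzkinAtOne + X * closedGF ^ 2
    + X * comp closedGF (X * (1 - 2 * X * motzkinAtOne)⁻¹) := by
  have h := openGF_eq 0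
  have h1 := openGF_succ 0
  rw [Nat.cast_zero, map_zero] at h
  rw [closedGF_eq_openGF]
  linear_combination h + X * h1

theorem X_mul_inv_mul {F : PowerSeries ℝ} (h : constantCoeff F ≠ 0) : X * F⁻¹ * F = X := by
  rw [mul_assoc, PowerSeries.inv_mul_cancel _ h, mul_one]

/-- The solution `Λ(z / (1 + z))` of the indirect equation. -/
theorem indirectEquation_comp_closedGF : IndirectEquation (comp closedGF (X * (1 + X)⁻¹)) := by
  have hW0 : constantCoeff (X * (1 + X)⁻¹ : PowerSeries ℝ) = 0 := constantCoeff_X_mul_eq_zero _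
  have hW : X * (1 + X)⁻¹ * (1 + X) = (X : PowerSeries ℝ) := X_mul_inv_mul (by simp)
  have hP0 : constantCoeff (X * (1 - 2 * X * motzkinAtOne)⁻¹) = 0 :=
    constantCoeff_X_mul_eq_zero _
  have hP : X * (1 - 2 * X * motzkinAtOne)⁻¹ * (1 - 2 * X * motzkinAtOne) = X :=
    X_mul_inv_mul (by simp)
  have hV0 : constantCoeff (X * (1 - 2 * catalanC)⁻¹) = 0 := constantCoeff_X_mul_eq_zero _
  have hV : X * (1 - 2 * catalanC)⁻¹ * (1 - 2 * catalanC) = X :=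
    X_mul_inv_mul (by simp [constantCoeff_catalanC])
  unfold IndirectEquation
  have hL := closedGF_functional
  have hM := motzkinAtOne_functional
  -- From here the quotients are known only through their denominator-free equations.
  generalize (X * (1 + X)⁻¹ : PowerSeries ℝ) = W at *
  generalize X * (1 - 2 * X * motzkinAtOne)⁻¹ = P at *
  generalize X * (1 - 2 * catalanC)⁻¹ = V at *
  obtain ⟨φ, h1, h2, -⟩ := exists_ringHom_comp hW0
  obtain ⟨ψ, k1, k2, -⟩ := exists_ringHom_comp hV0
  have hC : X * φ motzkinAtOne = catalanC := by
    refine eq_catalanC (constantCoeff_X_mul_eq_zero _) ?_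
    have := congrArg φ hM
    simp only [map_mul, map_add, map_pow, map_one, h2] at this
    linear_combination X * (1 + X) * this
      + X * (1 + (φ motzkinAtOne + φ motzkinAtOne ^ 2)) * hW
  -- Both composites equal z/(1 - 2C + z), using zM(W) = C; hence Λ(P(W)) = Λ(W(V)).
  have hPW : comp W V = comp P W := by
    have ha := congrArg ψ hW
    have hb := congrArg φ hP
    simp only [map_mul, map_add, map_sub, map_one, map_ofNat, h2, k2] at ha hb
    rw [← k1, ← h1]
    have hne : 1 - 2 * catalanC + X ≠ 0 := fun h => by
      have := congrArg constantCoeff h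
      simp [constantCoeff_catalanC] at this
    refine mul_right_cancel₀ hne ?_
    linear_combination (1 - 2 * catalanC) * ha + (1 - ψ W) * hV - (1 + X) * hb
      - (1 + 2 * φ P * φ motzkinAtOne) * hW - 2 * φ P * hC
  rw [comp_comp _ hW0 hV0, hPW, ← comp_comp _ hP0 hW0, ← h1, ← h1]
  have := congrArg φ hL
  simp only [map_mul, map_add, map_pow, h2] at this
  -- The factor 1 + z clears the denominator of W and accounts for the term -zL.
  linear_combination (1 + X) * this + hC
    + (φ motzkinAtOne + φ closedGF ^ 2 + φ (comp closedGF P)) * hW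

theorem comp_comp_closedGF :
    comp (comp closedGF (X * (1 + X)⁻¹)) (X * (1 - X)⁻¹) = closedGF := by
  have hW0 : constantCoeff (X * (1 + X)⁻¹ : PowerSeries ℝ) = 0 := constantCoeff_X_mul_eq_zero _
  have hW : X * (1 + X)⁻¹ * (1 + X) = (X : PowerSeries ℝ) := X_mul_inv_mul (by simp)
  have hQ0 : constantCoeff (X * (1 - X)⁻¹ : PowerSeries ℝ) = 0 := constantCoeff_X_mul_eq_zero _
  have hQ : X * (1 - X)⁻¹ * (1 - X) = (X : PowerSeries ℝ) := X_mul_inv_mul (by simp)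
  rw [comp_comp _ hW0 hQ0]
  generalize (X * (1 + X)⁻¹ : PowerSeries ℝ) = W at *
  generalize (X * (1 - X)⁻¹ : PowerSeries ℝ) = Q at *
  obtain ⟨φ, h1, h2, -⟩ := exists_ringHom_comp hQ0
  have ha := congrArg φ hW
  simp only [map_mul, map_add, map_one, h2] at ha
  have hX : comp W Q = X := by
    rw [← h1]
    linear_combination (1 - X) * ha + (1 - φ W) * hQ
  rw [hX]
  exact X_subst closedGF

end

end LambdaEnum

theorem mainTheorem5 :
    LambdaEnum.catalanC = LambdaEnum.rootedBinaryGF ∧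
    (∃! L : PowerSeries ℝ, LambdaEnum.IndirectEquation L) ∧
    (∀ L : PowerSeries ℝ, LambdaEnum.IndirectEquation L →
      LambdaEnum.closedGF =
        LambdaEnum.comp L (PowerSeries.X * (1 - PowerSeries.X)⁻¹)) ∧
    LambdaEnum.closedGF =
      PowerSeries.X * LambdaEnum.motzkinAtOne
        + PowerSeries.X * LambdaEnum.closedGF ^ 2
        + PowerSeries.X * LambdaEnum.comp LambdaEnum.closedGF
            (PowerSeries.X * (1 - 2 * PowerSeries.X * LambdaEnum.motzkinAtOne)⁻¹) := by
  refine ⟨LambdaEnum.catalanC_eq_rootedBinaryGF,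
    ⟨_, LambdaEnum.indirectEquation_comp_closedGF, fun L hL =>
      LambdaEnum.indirectEquation_unique hL LambdaEnum.indirectEquation_comp_closedGF⟩,
    fun L hL => ?_, LambdaEnum.closedGF_functional⟩
  rw [LambdaEnum.indirectEquation_unique hL LambdaEnum.indirectEquation_comp_closedGF]
  exact LambdaEnum.comp_comp_closedGF.symm
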